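/- Let $m,n,a,b$ be nonnegative integers and write $[k]=\{1,\dots,k\}$. A linear code $\mathcal{C}\subseteq\mathbb{F}_q^{m\times n}$ over a finite field $\mathbb{F}_q$ \emph{instantiates the product topology $T_{m,n}(a,b,0)$} if there are a matrix $H_{\mathrm{row}}\in\mathbb{F}_q^{b\times n}$ and a matrix $H_{\mathrm{col}}\in\mathbb{F}_q^{a\times m}$ (neither is required to have full rank) such that $\mathcal{C}$ consists of exactly those $C\in\mathbb{F}_q^{m\times n}$ for which every row $r$ of $C$ satisfies $H_{\mathrm{row}}\,r^{t}=0$ and every column $c$ of $C$ satisfies $H_{\mathrm{col}}\,c=0$. An erasure pattern $E\subseteq[m]\times[n]$ is \emph{recoverable} for $T_{m,n}(a,b,0)$ if, over some finite field, there is a code $\mathcal{C}$ instantiating $T_{m,n}(a,b,0)$ such that $\dim\bigl(\mathcal{C}|_{([m]\times[n])\setminus E}\bigr)=\dim(\mathcal{C})$, where $\mathcal{C}|_{S}$ denotes the code obtained by restricting all codewords of $\mathcal{C}$ to the coordinates in $S$. An erasure pattern $E\subseteq[m]\times[n]$ is \emph{regular} for $T_{m,n}(a,b,0)$ if for all $U\subseteq[m]$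 and $V\subseteq[n]$, with $u=|U|$ and $v=|V|$, $$|E\cap(U\times V)|\;\le\; uv-\max(u-a,0)\,\max(v-b,0).$$ **Theorem.** For all $m,n,b$, every erasure pattern $E\subseteq[m]\times[n]$ that is regular for the topology $T_{m,n}(1,b,0)$ is recoverable for $T_{m,n}(1,b,0)$. -/

import Mathlib

namespace GridTopology

/-- A linear code `C`, whose codewords are `m × n` matrices over `F`, instantiates the topology
`T_{m,n}(a, b, h)`: for some `b × n` matrix `Hrow`, `a × m` matrix `Hcol` and `h × mn` matrix
`Hglob` (none of them required to have full rank), `C` is the code cut out by these parity checks,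
i.e. it consists of precisely those matrices each of whose rows is checked by `Hrow`, each of whose
columns is checked by `Hcol`, and whose vectorization is checked by `Hglob`. For `h = 0` this says
that `C` is the product of the codes with parity-check matrices `Hcol` and `Hrow`.
(The columns of `Hglob` are indexed by the positions of the grid.) -/
def Instantiates {F : Type*} [Field F] {m n : ℕ} (a b h : ℕ)
    (C : Submodule F (Matrix (Fin m) (Fin n) F)) : Prop :=
  ∃ (Hrow : Matrix (Fin b) (Fin n) F) (Hcol : Matrix (Fin a) (Fin m) F)
    (Hglob : Matrix (Fin h) (Fin m × Fin n) F),
    ∀ X : Matrix (Fin m) (Fin n) F, X ∈ C ↔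
      (∀ i : Fin m, Hrow.mulVec (fun j => X i j) = 0) ∧
      (∀ j : Fin n, Hcol.mulVec (fun i => X i j) = 0) ∧
      Hglob.mulVec (fun p => X p.1 p.2) = 0

/-- Restriction of a word to the non-erased coordinates, i.e. to the complement of `E`. -/
def restrictCompl (F : Type*) [Field F] {m n : ℕ} (E : Finset (Fin m × Fin n)) :
    Matrix (Fin m) (Fin n) F →ₗ[F] ({p : Fin m × Fin n // p ∉ E} → F) where
  toFun X := fun p => X p.1.1 p.1.2
  map_add' _ _ := rfl
  map_smul' _ _ := rfl

/-- The code obtained from `C` by puncturing to the non-erased coordinates. -/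
def punctured {F : Type*} [Field F] {m n : ℕ} (C : Submodule F (Matrix (Fin m) (Fin n) F))
    (E : Finset (Fin m × Fin n)) : Submodule F ({p : Fin m × Fin n // p ∉ E} → F) :=
  C.map (restrictCompl F E)

/-- The erasure pattern `E` is recoverable for `T_{m,n}(a, b, h)`: over some finite field there is
a code instantiating the topology whose dimension does not drop when the coordinates in `E`
are deleted. -/
def IsRecoverable {m n : ℕ} (a b h : ℕ) (E : Finset (Fin m × Fin n)) : Prop :=
  ∃ (F : Type) (_ : Field F) (_ : Finite F) (C : Submodule F (Matrix (Fin m) (Fin n) F)),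
    Instantiates a b h C ∧ Module.finrank F (punctured C E) = Module.finrank F C

/-- The erasure pattern `E` is regular for the product topology `T_{m,n}(a, b, 0)`. -/
def IsRegular {m n : ℕ} (a b : ℕ) (E : Finset (Fin m × Fin n)) : Prop :=
  ∀ (U : Finset (Fin m)) (V : Finset (Fin n)),
    ((E ∩ (U ×ˢ V)).card : ℤ) ≤
      (U.card : ℤ) * (V.card : ℤ)
        - max ((U.card : ℤ) - (a : ℤ)) 0 * max ((V.card : ℤ) - (b : ℤ)) 0

end GridTopology

/-!
With a single column parity check, take that check to be the all-ones row. A codeword `X` supported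
on `E` then consists of rows `Xᵢ`, where `Xᵢ` lies in the row code `W`, is supported on the `i`-th
row `Eᵢ` of `E`, and `∑ Xᵢ = 0`. So `E` is recoverable as soon as, for some `W` of codimension at
most `b`, the subspaces `Wᵢ` of words of `W` supported on `Eᵢ` are linearly independent.

Such a `W` is the row space of a matrix with prescribed zeros: for each `i` it has `|Eᵢ| - b` rows
with support `Eᵢ` (none if `|Eᵢ| ≤ b`), and it is filled up to `n - b` rows by rows with full
support. Regularity for the union of the `Eᵢ` concerned says that any nonempty set `I` of these rows
has supports covering at least `b + |I|` columns (`IsRegular.add_card_le_card_biUnion`). By Hall's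
marriage theorem every maximal minor is then a nonzero polynomial in the free entries, so the
entries can be chosen in some prime field with all maximal minors nonzero
(`exists_zmod_matrix_minors_ne_zero`). Now `W` is an MDS code: a word of `W` vanishing on `n - b`
columns is zero (`eq_zero_of_vecMul_eq_zero_on`). Therefore `Wᵢ` has dimension at most `|Eᵢ| - b`,
and so it is spanned by the rows reserved for `i` (`exists_eq_vecMul_of_support`). As all rows of
the matrix are independent, so are the `Wᵢ`.
-/

namespace GridTopology

open Finset Matrix

/-! ### Matrices with prescribed zeros and nonvanishing maximal minors -/

/-- A matrix with support pattern `S` and generic entries has no vanishing maximal minor, provided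
that `S` satisfies Hall's condition on every set of `card ι` columns; the entries can be taken in a
prime field. In the hypothesis, `card α - card ι` is the number of columns outside a maximal
minor. -/
theorem exists_zmod_matrix_minors_ne_zero {ι α : Type*} [Fintype ι] [DecidableEq ι] [Fintype α]
    [DecidableEq α] (S : ι → Finset α)
    (hS : ∀ I : Finset ι, I.Nonempty →
      Fintype.card α + #I ≤ #(I.biUnion S) + Fintype.card ι) :
    ∃ (p : ℕ) (_ : p.Prime) (A : Matrix ι α (ZMod p)),
      (∀ i a, a ∉ S i → A i a = 0) ∧ ∀ e : ι ↪ α, (A.submatrix id e).det ≠ 0 := by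
  let G : Matrix ι α (MvPolynomial (ι × α) ℤ) :=
    fun i a => if a ∈ S i then MvPolynomial.X (i, a) else 0
  have hG_mem {i a} (h : a ∈ S i) : G i a = MvPolynomial.X (i, a) := if_pos h
  have hG_notMem {i a} (h : a ∉ S i) : G i a = 0 := if_neg h
  have hminor (e : ι ↪ α) : (G.submatrix id e).det ≠ 0 := by
    obtain ⟨f, hf, hfS⟩ :=
      (Finset.all_card_le_biUnion_card_iff_exists_injective
        (fun i => univ.filter fun k => e k ∈ S i)).1 (by
        intro I
        rcases I.eq_empty_or_nonempty with rfl | hI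
        · simp
        have h1 := hS I hI
        -- Only the columns outside the range of `e` can be lost from the union of the supports.
        have h2 : I.biUnion S ⊆
            (I.biUnion fun i => univ.filter fun k => e k ∈ S i).map e ∪ (univ.map e)ᶜ := by
          intro a ha
          by_cases hae : a ∈ univ.map e
          · obtain ⟨k, -, rfl⟩ := Finset.mem_map.1 hae
            refine mem_union_left _ (mem_map_of_mem _ ?_)
            simpa using ha
          · exact mem_union_right _ (mem_compl.2 hae)
        have h3 := (card_le_card h2).trans (card_union_le _ _)
        rw [card_map, card_compl, card_map, card_univ] at h3
        have h4 := Fintype.card_le_of_embedding e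
        omega)
    let σ : Equiv.Perm ι := Equiv.ofBijective f (Finite.injective_iff_bijective.1 hf)
    intro h0
    -- Specialize the minor to the permutation matrix of the matching `f`.
    have h1 := congrArg (MvPolynomial.eval
      fun q : ι × α => if q.2 = e (f q.1) then (1 : ℤ) else 0) h0
    rw [RingHom.map_det, map_zero] at h1
    have h2 : (MvPolynomial.eval
        fun q : ι × α => if q.2 = e (f q.1) then (1 : ℤ) else 0).mapMatrix (G.submatrix id e)
        = (1 : Matrix ι ι ℤ).submatrix σ id := by
      ext i k
      have hi := (mem_filter.1 (hfS i)).2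
      by_cases hk : k = f i
      · subst hk
        simp [hG_mem hi, σ, one_apply]
      · have hk' : f i ≠ k := fun h => hk h.symm
        by_cases hkS : e k ∈ S i
        · simp [hG_mem hkS, hk, hk', σ, one_apply]
        · simp [hG_notMem hkS, hk', σ, one_apply]
    rw [h2, det_permute, det_one, mul_one] at h1
    exact (Units.ne_zero _) (by exact_mod_cast h1)
  have hprod : (∏ e : ι ↪ α, (G.submatrix id e).det) ≠ 0 :=
    prod_ne_zero_iff.2 fun e _ => hminor e
  obtain ⟨x, hx⟩ : ∃ x, MvPolynomial.eval x (∏ e : ι ↪ α, (G.submatrix id e).det) ≠ 0 := by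
    by_contra! h
    exact hprod (MvPolynomial.funext fun x => by rw [h x, map_zero])
  set N := MvPolynomial.eval x (∏ e : ι ↪ α, (G.submatrix id e).det)
  -- A prime exceeding `|N|` does not divide the product `N` of the minors at the integer point `x`.
  obtain ⟨p, hpN, hp⟩ := Nat.exists_infinite_primes (N.natAbs + 1)
  have : Fact p.Prime := ⟨hp⟩
  let φ : MvPolynomial (ι × α) ℤ →+* ZMod p :=
    (Int.castRingHom (ZMod p)).comp (MvPolynomial.eval x)
  refine ⟨p, hp, G.map φ, fun i a ha => by simp [hG_notMem ha], fun e he => ?_⟩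
  have h1 : φ (G.submatrix id e).det = 0 := by
    rw [RingHom.map_det]
    exact he
  have h2 : (N : ZMod p) = 0 := by
    have : (N : ZMod p) = φ (∏ e : ι ↪ α, (G.submatrix id e).det) := rfl
    rw [this, map_prod]
    exact prod_eq_zero (mem_univ e) h1
  rw [ZMod.intCast_zmod_eq_zero_iff_dvd] at h2
  have h3 := Nat.le_of_dvd (Int.natAbs_pos.2 hx) (Int.natCast_dvd.1 h2)
  omega

/-- The rows supported on the sets `T k` can be completed, by rows without prescribed zeros, to
`card α - b` rows with nonvanishing maximal minors. For `b ≥ card α` there are no rows at all, and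
the subtraction truncates accordingly. -/
theorem exists_zmod_matrix_extend {κ α : Type*} [Fintype κ] [DecidableEq κ] [Fintype α]
    [DecidableEq α] (b : ℕ) (T : κ → Finset α)
    (hT : ∀ I : Finset κ, I.Nonempty → b + #I ≤ #(I.biUnion T)) :
    ∃ r, Fintype.card (κ ⊕ Fin r) = Fintype.card α - b ∧
      ∃ (p : ℕ) (_ : p.Prime) (A : Matrix (κ ⊕ Fin r) α (ZMod p)),
        (∀ k a, a ∉ T k → A (Sum.inl k) a = 0) ∧
        ∀ e : κ ⊕ Fin r ↪ α, (A.submatrix id e).det ≠ 0 := by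
  have hκ : Fintype.card κ ≤ Fintype.card α - b := by
    rcases isEmpty_or_nonempty κ with h | h
    · simp
    have h1 := hT univ univ_nonempty
    have h2 := card_le_univ ((univ : Finset κ).biUnion T)
    rw [card_univ] at h1
    omega
  have hι : Fintype.card (κ ⊕ Fin (Fintype.card α - b - Fintype.card κ)) =
      Fintype.card α - b := by
    simp only [Fintype.card_sum, Fintype.card_fin]
    omega
  refine ⟨_, hι, ?_⟩
  obtain ⟨p, hp, A, hAS, hA⟩ :=
    exists_zmod_matrix_minors_ne_zero (Sum.elim T fun _ : Fin _ => univ) (by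
    intro I hI
    rw [hι]
    -- A set containing an added row covers all columns.
    by_cases hr : ∃ y, Sum.inr y ∈ I
    · obtain ⟨y, hy⟩ := hr
      have h1 := card_le_card (subset_biUnion_of_mem (Sum.elim T fun _ : Fin _ => univ) hy)
      have h2 := card_le_univ I
      simp only [Sum.elim_inr, card_univ] at h1
      omega
    · push Not at hr
      have hIJ : I = I.toLeft.map Function.Embedding.inl := by
        ext (x | y)
        · simp
        · simp [hr]
      have h1 := hT I.toLeft (by
        rw [hIJ] at hI
        exact Finset.map_nonempty.1 hI)
      have h2 : I.toLeft.biUnion T = I.biUnion (Sum.elim T fun _ : Fin _ => univ) := by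
        conv_rhs => rw [hIJ]
        ext a
        simp
      have h3 : #I = #I.toLeft := by
        conv_lhs => rw [hIJ, card_map]
      rw [h2] at h1
      omega)
  exact ⟨p, hp, A, fun k a ha => hAS (Sum.inl k) a ha, hA⟩

/-! ### The row space as an MDS code -/

/-- The MDS property of the row space of `A`: no nonzero word vanishes on `card ι` columns. -/
theorem eq_zero_of_vecMul_eq_zero_on {ι α F : Type*} [Fintype ι] [DecidableEq ι] [Field F]
    {A : Matrix ι α F}
    (hA : ∀ e : ι ↪ α, (A.submatrix id e).det ≠ 0) {Z : Finset α} (hZ : Fintype.card ι ≤ #Z)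
    {v : ι → F} (hv : ∀ a ∈ Z, (v ᵥ* A) a = 0) : v = 0 := by
  obtain ⟨e⟩ := Function.Embedding.nonempty_of_card_le
    (show Fintype.card ι ≤ Fintype.card Z by rwa [Fintype.card_coe])
  refine eq_zero_of_vecMul_eq_zero (hA (e.trans (Function.Embedding.subtype _))) ?_
  ext k
  exact hv _ (e k).2

/-- If sufficiently many rows of `A` (those indexed by `κ`) are supported on `T`, they span all
the words of the row space of `A` that are supported on `T`. Here `card α - card ι` is the
codimension of the row space. -/
theorem exists_eq_vecMul_of_support {ι κ α F : Type*} [Fintype ι] [DecidableEq ι] [Fintype κ]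
    [Fintype α] [DecidableEq α] [Field F] {A : Matrix ι α F}
    (hA : ∀ e : ι ↪ α, (A.submatrix id e).det ≠ 0) (r : κ ↪ ι) {T : Finset α}
    (hr : ∀ t, ∀ a ∉ T, A (r t) a = 0) (hκT : Fintype.card κ ≤ #T)
    (hκ : Fintype.card ι + #T ≤ Fintype.card κ + Fintype.card α)
    {v : ι → F} (hv : ∀ a ∉ T, (v ᵥ* A) a = 0) :
    ∃ c : κ → F, v = ∑ t, Pi.single (r t) (c t) := by
  obtain ⟨D, hDT, hD⟩ := exists_subset_card_eq hκT
  -- A word of the row space that is supported on `T` is determined by its values on `D`.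
  have hcard : Fintype.card ι ≤ #(Tᶜ ∪ D) := by
    rw [card_union_of_disjoint (disjoint_compl_left.mono_right hDT), card_compl]
    have := card_le_univ T
    omega
  let ext : (κ → F) →ₗ[F] (ι → F) := ∑ t, LinearMap.single F (fun _ => F) (r t) ∘ₗ LinearMap.proj t
  have hext (c : κ → F) : ext c = ∑ t, Pi.single (r t) (c t) := by
    simp [ext, LinearMap.sum_apply]
  have hext_r (c : κ → F) (t : κ) : ext c (r t) = c t := by
    rw [hext, Finset.sum_apply, Finset.sum_eq_single t] <;>
      simp +contextual [r.injective.eq_iff, eq_comm]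
  have hextT (c : κ → F) (a : α) (ha : a ∉ T) : (ext c ᵥ* A) a = 0 := by
    rw [hext, sum_vecMul, Finset.sum_apply]
    exact sum_eq_zero fun t _ => by simp [hr t a ha]
  let L : (κ → F) →ₗ[F] (D → F) := LinearMap.funLeft F F Subtype.val ∘ₗ A.vecMulLinear ∘ₗ ext
  have hL (c : κ → F) (a : D) : L c a = (ext c ᵥ* A) a := rfl
  have hinj : Function.Injective L := by
    rw [← LinearMap.ker_eq_bot, LinearMap.ker_eq_bot']
    intro c hc
    have h0 : ext c = 0 := eq_zero_of_vecMul_eq_zero_on hA hcard fun a ha => by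
      rcases mem_union.1 ha with ha | ha
      · exact hextT c a (mem_compl.1 ha)
      · exact congrFun hc ⟨a, ha⟩
    funext t
    rw [← hext_r c t, h0]
    rfl
  have hsurj : Function.Surjective L :=
    (LinearMap.injective_iff_surjective_of_finrank_eq_finrank (by simp [hD])).1 hinj
  obtain ⟨c, hc⟩ := hsurj fun a => (v ᵥ* A) a
  refine ⟨c, ?_⟩
  rw [← hext, ← sub_eq_zero]
  refine eq_zero_of_vecMul_eq_zero_on hA hcard fun a ha => ?_
  rw [sub_vecMul, Pi.sub_apply, sub_eq_zero]
  rcases mem_union.1 ha with ha | ha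
  · rw [hv a (mem_compl.1 ha), hextT c a (mem_compl.1 ha)]
  · rw [← hL c ⟨a, ha⟩, hc]

/-- A subspace of codimension at most `b` is cut out by `b` parity checks. -/
theorem exists_mulVec_eq_zero_iff_mem {F : Type*} [Field F] {n b : ℕ}
    (W : Submodule F (Fin n → F)) (hW : n ≤ Module.finrank F W + b) :
    ∃ H : Matrix (Fin b) (Fin n) F, ∀ x, H *ᵥ x = 0 ↔ x ∈ W := by
  have h1 := W.finrank_quotient_add_finrank
  rw [Module.finrank_fin_fun] at h1
  obtain ⟨f, hf⟩ := (finrank_le_iff_exists_linearMap (R := F) (M := (Fin n → F) ⧸ W)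
    (M' := Fin b → F)).1 (by rw [Module.finrank_fin_fun]; omega)
  refine ⟨LinearMap.toMatrix' (f ∘ₗ W.mkQ), fun x => ?_⟩
  rw [LinearMap.toMatrix'_mulVec, LinearMap.comp_apply, map_eq_zero_iff f hf,
    Submodule.mkQ_apply, Submodule.Quotient.mk_eq_zero]

/-! ### Regular patterns -/

/-- The set of columns in which the pattern `E` meets row `i`. -/
def rowSupport {m n : ℕ} (E : Finset (Fin m × Fin n)) (i : Fin m) : Finset (Fin n) :=
  univ.filter fun j => (i, j) ∈ E

/-- Regularity for `a = 1` yields Hall's condition, with surplus `b`, for the family in which each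
row support `Eᵢ` is repeated `|Eᵢ| - b` times. -/
theorem IsRegular.add_card_le_card_biUnion {m n b : ℕ} {E : Finset (Fin m × Fin n)}
    (hE : IsRegular 1 b E) (I : Finset (Σ i, Fin (#(rowSupport E i) - b))) (hI : I.Nonempty) :
    b + #I ≤ #(I.biUnion fun x => rowSupport E x.1) := by
  let U : Finset (Fin m) := I.image Sigma.fst
  let V : Finset (Fin n) := I.biUnion fun x => rowSupport E x.1
  have hlt : ∀ i ∈ U, b < #(rowSupport E i) := by
    intro i hi
    obtain ⟨x, -, rfl⟩ := mem_image.1 hi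
    have := x.2.pos
    omega
  have hsub : ∀ i ∈ U, rowSupport E i ⊆ V := by
    intro i hi
    obtain ⟨x, hx, rfl⟩ := mem_image.1 hi
    exact subset_biUnion_of_mem (fun x : Σ i, Fin (#(rowSupport E i) - b) => rowSupport E x.1) hx
  have hcardI : #I ≤ ∑ i ∈ U, (#(rowSupport E i) - b) := by
    have : I ⊆ U.sigma fun i => (univ : Finset (Fin (#(rowSupport E i) - b))) := fun x hx =>
      mem_sigma.2 ⟨mem_image_of_mem _ hx, mem_univ _⟩
    simpa using card_le_card this
  have hcardE : ∑ i ∈ U, #(rowSupport E i) ≤ #(E ∩ U ×ˢ V) := by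
    rw [← card_sigma]
    refine card_le_card_of_injOn (fun x => (x.1, x.2)) (fun x hx => ?_) ?_
    · obtain ⟨h1, h2⟩ := mem_sigma.1 hx
      exact mem_inter.2 ⟨(mem_filter.1 h2).2, mem_product.2 ⟨h1, hsub _ h1 h2⟩⟩
    · rintro ⟨i, j⟩ - ⟨i', j'⟩ - h
      simp only [Prod.mk.injEq] at h
      obtain ⟨rfl, rfl⟩ := h
      rfl
  have hUpos : 1 ≤ #U := card_pos.2 (hI.image _)
  have hVb : b ≤ #V := by
    obtain ⟨i, hi⟩ := hI.image Sigma.fst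
    exact (hlt i hi).le.trans (card_le_card (hsub i hi))
  have hreg := hE U V
  rw [max_eq_left (by push_cast; omega), max_eq_left (by omega)] at hreg
  have hsum : ∑ i ∈ U, (#(rowSupport E i) - b) + #U * b = ∑ i ∈ U, #(rowSupport E i) := by
    rw [← smul_eq_mul, ← sum_const, ← sum_add_distrib]
    exact sum_congr rfl fun i hi => Nat.sub_add_cancel (hlt i hi).le
  -- Regularity reads `∑ |Eᵢ| ≤ |U||V| - (|U| - 1)(|V| - b)`, whose right side is
  -- `|V| + (|U| - 1) b`.
  have hmain : (b : ℤ) + #I ≤ #V := by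
    zify at hcardI hcardE hsum
    push_cast at hreg
    nlinarith
  exact_mod_cast hmain

/-- The pattern is recoverable if some code instantiating the topology has no nonzero codeword
supported on the erased positions. -/
theorem isRecoverable_of_forall_eq_zero {m n a b h : ℕ} {E : Finset (Fin m × Fin n)}
    {F : Type} [Field F] [Finite F] {C : Submodule F (Matrix (Fin m) (Fin n) F)}
    (hC : Instantiates a b h C) (h0 : ∀ X ∈ C, (∀ i j, (i, j) ∉ E → X i j = 0) → X = 0) :
    IsRecoverable a b h E := by
  refine ⟨F, inferInstance, inferInstance, C, hC, ?_⟩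
  have hinj : Function.Injective ((restrictCompl F E).domRestrict C) := by
    rw [← LinearMap.ker_eq_bot, LinearMap.ker_eq_bot']
    intro X hX
    exact Subtype.ext (h0 X X.2 fun i j hij => congrFun hX ⟨(i, j), hij⟩)
  rw [← LinearMap.finrank_range_of_inj hinj, LinearMap.range_domRestrict]
  rfl

/-- The product code whose row code is `W` and whose only column check is the all-ones vector:
the rows of a codeword lie in `W` and sum to zero. -/
def zeroSumCode {F : Type*} [Field F] (m : ℕ) {n : ℕ} (W : Submodule F (Fin n → F)) :
    Submodule F (Matrix (Fin m) (Fin n) F) where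
  carrier := {X | (∀ i, X i ∈ W) ∧ ∀ j, ∑ i, X i j = 0}
  add_mem' := by
    rintro X Y ⟨hX, hX'⟩ ⟨hY, hY'⟩
    exact ⟨fun i => W.add_mem (hX i) (hY i), fun j => by simp [sum_add_distrib, hX' j, hY' j]⟩
  zero_mem' := ⟨fun _ => W.zero_mem, fun j => by simp⟩
  smul_mem' := by
    rintro c X ⟨hX, hX'⟩
    exact ⟨fun i => W.smul_mem c (hX i), fun j => by simp [← mul_sum, hX' j]⟩

theorem instantiates_zeroSumCode {F : Type*} [Field F] (m : ℕ) {n b : ℕ}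
    (W : Submodule F (Fin n → F)) (hW : n ≤ Module.finrank F W + b) :
    Instantiates 1 b 0 (zeroSumCode m W) := by
  obtain ⟨H, hH⟩ := exists_mulVec_eq_zero_iff_mem W hW
  refine ⟨H, fun _ _ => 1, 0, fun X => ?_⟩
  have hcol : (∀ j, (fun _ _ => 1 : Matrix (Fin 1) (Fin m) F) *ᵥ (fun i => X i j) = 0) ↔
      ∀ j, ∑ i, X i j = 0 := by
    simp [funext_iff, mulVec, dotProduct]
  rw [hcol]
  have hrow : (∀ i, H *ᵥ (fun j => X i j) = 0) ↔ ∀ i, X i ∈ W := forall_congr' fun i => hH _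
  rw [hrow]
  exact ⟨fun h => ⟨h.1, h.2, Subsingleton.elim _ _⟩, fun h => ⟨h.1, h.2.1⟩⟩

end GridTopology

open GridTopology Finset Matrix in
theorem mainTheorem1 (m n b : ℕ) (E : Finset (Fin m × Fin n))
    (hE : GridTopology.IsRegular 1 b E) :
    GridTopology.IsRecoverable 1 b 0 E := by
  obtain ⟨r, hι, p, hp, A, hAS, hA⟩ :=
    exists_zmod_matrix_extend b _ hE.add_card_le_card_biUnion
  rw [Fintype.card_fin] at hι
  have hmk (i : Fin m) : Function.Injective fun t =>
      (Sum.inl ⟨i, t⟩ : (Σ i, Fin (#(rowSupport E i) - b)) ⊕ Fin r) :=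
    Sum.inl_injective.comp sigma_mk_injective
  have : Fact p.Prime := ⟨hp⟩
  have hinj : Function.Injective A.vecMulLinear := by
    rw [← LinearMap.ker_eq_bot, LinearMap.ker_eq_bot']
    intro v hv
    refine eq_zero_of_vecMul_eq_zero_on hA (Z := univ) ?_ fun a _ => congrFun hv a
    rw [hι, card_univ, Fintype.card_fin]
    omega
  let W := LinearMap.range A.vecMulLinear
  have hW : n ≤ Module.finrank (ZMod p) W + b := by
    rw [LinearMap.finrank_range_of_inj hinj, Module.finrank_fintype_fun_eq_card, hι]
    omega
  refine isRecoverable_of_forall_eq_zero (instantiates_zeroSumCode m W hW) ?_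
  rintro X ⟨hXW, hX0⟩ hXE
  choose v hv using hXW
  have hrows (i : Fin m) : ∃ c : Fin (#(rowSupport E i) - b) → ZMod p,
      v i = ∑ t, Pi.single (Sum.inl ⟨i, t⟩) (c t) := by
    refine exists_eq_vecMul_of_support hA (T := rowSupport E i)
      ⟨fun t => Sum.inl ⟨i, t⟩, hmk i⟩ ?_ ?_ ?_ ?_
    · exact fun t a ha => hAS _ _ ha
    · rw [Fintype.card_fin]
      omega
    · rw [hι, Fintype.card_fin, Fintype.card_fin]
      have := card_le_univ (rowSupport E i)
      rw [Fintype.card_fin] at this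
      omega
    · intro a ha
      have : A.vecMulLinear (v i) a = 0 := by
        rw [hv i]
        exact hXE i a fun h => ha (mem_filter.2 ⟨mem_univ _, h⟩)
      exact this
  choose c hc using hrows
  have hsum : ∑ i, v i = 0 := by
    refine hinj ?_
    rw [map_sum, map_zero]
    funext j
    rw [Finset.sum_apply]
    exact (sum_congr rfl fun i _ => congrFun (hv i) j).trans (hX0 j)
  -- The coefficient vectors of different rows of `X` have disjoint supports.
  have hc0 (i : Fin m) (t : Fin (#(rowSupport E i) - b)) : c i t = 0 := by
    have h1 := congrFun hsum (Sum.inl ⟨i, t⟩)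
    have h2 (i' : Fin m) (h : i' ≠ i) : v i' (Sum.inl ⟨i, t⟩) = 0 := by
      rw [hc, Finset.sum_apply]
      refine sum_eq_zero fun t' _ => Pi.single_eq_of_ne (fun h' => h ?_) _
      exact (congrArg Sigma.fst (Sum.inl_injective h')).symm
    rw [Finset.sum_apply, sum_eq_single i (fun i' _ => h2 i') (by simp), hc, Finset.sum_apply,
      sum_eq_single t _ (by simp), Pi.single_eq_same] at h1
    · exact h1
    · exact fun t' _ h => Pi.single_eq_of_ne (fun h' => h (hmk i h'.symm)) _
  ext i j
  rw [← hv i, hc i]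
  simp [hc0]
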